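/- Let $\tau\in\mathbb C$ with $\operatorname{Im}\tau>0$, put $q=e^{2\pi i\tau}$ (so $0<|q|<1$), and write $q^{r}=e^{2\pi i r\tau}$ for $r\in\mathbb Q$. Let $(x;q)_n=\prod_{i=0}^{n-1}(1-q^{i}x)$ and, for $0\le k\le n$, $\binom{n}{k}_q=\frac{(q;q)_n}{(q;q)_k(q;q)_{n-k}}$. For $k,\ell\in\mathbb Z$ define $$\beta_{k,\ell}(q)=\begin{cases}\dfrac{(-1)^{k+\ell}q^{\frac32k(k+1)+\frac12\ell(\ell+1)+k+1}(q;q)_{-\ell-1}}{(q;q)_{-2k-2}\,(q;q)_{k-\ell}}&\text{if }\ell\le k\le-1,\\[2mm]0&\text{otherwise,}\end{cases}$$ and, for $m,n\in\mathbb Z$, $$Z_{m,n}(q)=\sum_{k,\ell\in\mathbb Z}\beta_{k,\ell}(q)\,q^{mk+n\ell}=\sum_{0\le k\le\ell}(-1)^{k+\ell}q^{\frac32k(k+1)+\frac12\ell(\ell+1)-(m+1)k-m-n\ell-n}\frac{(q;q)_\ell}{(q;q)_{2k}(q;q)_{\ell-k}}.$$ For $N\in\mathbb Z_{\ge0}$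 let $\theta_N(q)=q^{2(N+3/4)^2}-q^{2(N+7/4)^2}-q^{2(N+1/4)^2}+q^{2(N+5/4)^2}$, let $$\widehat Z(q)=q^{3/8}\sum_{k,j,\ell=0}^{\infty}\theta_{k+j+\ell}(q)\binom{k+j}{j}_q\binom{k+\ell}{\ell}_{q^{-1}}$$ be the series given by the Gukov--Manolescu surgery formula for $-1/2$ surgery on the figure-eight knot, and for $m\in\mathbb Z$ let $$\widehat Z_m(q)=q^{3/8}\sum_{k,j,\ell=0}^{\infty}\theta_{k+j+\ell}(q)\binom{k+j}{j}_q\binom{k+\ell}{\ell}_{q^{-1}}\,q^{-mk-m}.$$ Then for every $m\in\mathbb Z$ the series defining $\widehat Z_m(q)$ and $Z_{m,0}(q)$ converge absolutely, and $$\widehat Z_m(q)=-q^{1/2}Z_{m,0}(q).$$ In particular, the series defining $\widehat Z(q)$ converges absolutely and $\widehat Z(q)=-q^{1/2}Z_{0,0}(q)$. -/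

import Mathlib

noncomputable section

namespace FigEightSurgery

/-- The power `q ^ r` for a rational exponent `r`, where `q = exp (2 π i τ)`:
`q ^ r = exp (2 π i r τ)`. -/
def qpow (τ : ℂ) (r : ℚ) : ℂ :=
  Complex.exp (2 * Real.pi * Complex.I * (r : ℂ) * τ)

/-- The `q`-Pochhammer symbol `(x; q)_n = (1 - x) (1 - q x) ⋯ (1 - q ^ (n - 1) x)`. -/
def qPoch (x q : ℂ) (n : ℕ) : ℂ :=
  ∏ i ∈ Finset.range n, (1 - q ^ i * x)

/-- The `q`-binomial coefficient `(q; q)_n / ((q; q)_k (q; q)_{n - k})`, for `k ≤ n` (and `0`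
for `n < k`). It is used only at `q` which are neither zero nor roots of unity, where no
denominator vanishes. -/
def qBinom (q : ℂ) (n k : ℕ) : ℂ :=
  if k ≤ n then qPoch q q n / (qPoch q q k * qPoch q q (n - k)) else 0

/-- The second solution `β : ℤ² → ℚ(q)` of the recursions satisfied by the summand of the WRT
invariant, evaluated at a complex number `q`. The integer divisions by two are exact, and the
arguments of `Int.toNat` are nonnegative in the branch where they are used. -/
def beta (q : ℂ) (k l : ℤ) : ℂ :=
  if l ≤ k ∧ k ≤ -1 then
    (-1) ^ (k + l) * q ^ (3 * k * (k + 1) / 2 + l * (l + 1) / 2 + k + 1) *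
      qPoch q q (-l - 1).toNat / (qPoch q q (-2 * k - 2).toNat * qPoch q q (k - l).toNat)
  else 0

/-- The summand of `Z_{m,n}(q)`. -/
def ZTerm (m n : ℤ) (q : ℂ) (p : ℤ × ℤ) : ℂ :=
  beta q p.1 p.2 * q ^ (m * p.1 + n * p.2)

/-- `Z_{m,n}(q) = ∑_{k,l ∈ ℤ} β_{k,l}(q) q ^ (m k + n l)`. -/
def Z (m n : ℤ) (q : ℂ) : ℂ :=
  ∑' p : ℤ × ℤ, ZTerm m n q p

/-- The theta-like factor
`q^{2(N+3/4)²} - q^{2(N+7/4)²} - q^{2(N+1/4)²} + q^{2(N+5/4)²}`. -/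
def thetaTerm (τ : ℂ) (N : ℕ) : ℂ :=
  qpow τ (2 * ((N : ℚ) + 3 / 4) ^ 2) - qpow τ (2 * ((N : ℚ) + 7 / 4) ^ 2)
    - qpow τ (2 * ((N : ℚ) + 1 / 4) ^ 2) + qpow τ (2 * ((N : ℚ) + 5 / 4) ^ 2)

/-- The summand, indexed by `(k, j, l)`, of the surgery formula series `Ẑ(q)`. -/
def ZhatTerm (τ : ℂ) (p : ℕ × ℕ × ℕ) : ℂ :=
  thetaTerm τ (p.1 + p.2.1 + p.2.2) *
    qBinom (qpow τ 1) (p.1 + p.2.1) p.2.1 * qBinom (qpow τ 1)⁻¹ (p.1 + p.2.2) p.2.2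

/-- The surgery formula series `Ẑ(q)`, with `q = exp (2 π i τ)`. -/
def Zhat (τ : ℂ) : ℂ :=
  qpow τ (3 / 8) * ∑' p : ℕ × ℕ × ℕ, ZhatTerm τ p

/-- The summand, indexed by `(k, j, l)`, of `Ẑ_m(q)`. -/
def ZhatTermM (m : ℤ) (τ : ℂ) (p : ℕ × ℕ × ℕ) : ℂ :=
  ZhatTerm τ p * (qpow τ 1) ^ (-m * (p.1 : ℤ) - m)

/-- The series `Ẑ_m(q)`, with `q = exp (2 π i τ)`. -/
def ZhatM (m : ℤ) (τ : ℂ) : ℂ :=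
  qpow τ (3 / 8) * ∑' p : ℕ × ℕ × ℕ, ZhatTermM m τ p

end FigEightSurgery

end

namespace FigEightSurgery

open Finset

/-! Fix k and sum over j and l. By `thetaTerm_eq`, the theta factor is -q^(1/8) times w(N) - w(N+1)
with w = `thetaDiff`. It depends only on k + j + l, so the q-binomials enter only through their
convolution c_s = `binomConv q k s`. Their generating functions are reciprocals of products of
linear factors, and multiplying by 1 - X removes the one factor that the two products share. Hence
c_(s+1) - c_s is a single q-binomial (`binomConv_succ_sub`), and summation by parts leaves one
series in s. `tsum_watson` turns that series into the inner sum of Z_{m,0}; this is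
`tsum_surgery_fiber`. The factor q^(-mk-m) is constant for fixed k, so m matters only for
convergence.

`tsum_watson` evaluates a double series in two orders: one order uses the finite sum `sum_bailey`,
the other `hasSum_one_phi_one`. Both of these follow from telescoping certificates. Absolute
convergence comes from uniform bounds on (q;q)_n and its inverse together with the quadratic
exponents of q. -/

/-- The triangular number `n (n + 1) / 2`. -/
def tri (n : ℕ) : ℕ := n * (n + 1) / 2

lemma two_mul_tri (n : ℕ) : 2 * tri n = n * (n + 1) :=
  Nat.mul_div_cancel' (Nat.even_mul_succ_self n).two_dvd

lemma tri_zero : tri 0 = 0 := rfl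

lemma tri_add (m n : ℕ) : tri (m + n) = tri m + tri n + m * n := by
  have h1 := two_mul_tri m
  have h2 := two_mul_tri n
  have h3 := two_mul_tri (m + n)
  nlinarith

lemma tri_succ (n : ℕ) : tri (n + 1) = tri n + n + 1 := by
  rw [tri_add]; simp [tri]; ring

lemma le_tri (n : ℕ) : n ≤ tri n := by
  have h := two_mul_tri n
  nlinarith [Nat.le_mul_self n]

/-! ### q-Pochhammer symbols, q-binomials and their uniform bounds -/

lemma qPoch_zero (x q : ℂ) : qPoch x q 0 = 1 := by simp [qPoch]

lemma qPoch_self_succ (q : ℂ) (n : ℕ) :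
    qPoch q q (n + 1) = qPoch q q n * (1 - q ^ (n + 1)) := by
  simp [qPoch, prod_range_succ, pow_succ]

lemma one_sub_pow_succ_ne_zero {q : ℂ} (h1 : ‖q‖ < 1) (n : ℕ) : 1 - q ^ (n + 1) ≠ 0 := by
  intro h
  have h2 : ‖q ^ (n + 1)‖ < 1 := by
    rw [norm_pow]; exact pow_lt_one₀ (norm_nonneg _) h1 (by simp)
  rw [← sub_eq_zero.mp h] at h2
  simp at h2

lemma norm_one_sub_pow_le {q : ℂ} (h1 : ‖q‖ < 1) (n : ℕ) : ‖1 - q ^ n‖ ≤ 2 := by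
  refine (norm_sub_le _ _).trans ?_
  rw [norm_one, norm_pow]
  linarith [pow_le_one₀ (n := n) (norm_nonneg q) h1.le]

lemma qPoch_ne_zero {q : ℂ} (h1 : ‖q‖ < 1) (n : ℕ) : qPoch q q n ≠ 0 := by
  induction n with
  | zero => simp [qPoch_zero]
  | succ n ih => rw [qPoch_self_succ]; exact mul_ne_zero ih (one_sub_pow_succ_ne_zero h1 n)

lemma sum_range_pow_succ_le {x : ℝ} (h0 : 0 ≤ x) (h1 : x < 1) (n : ℕ) :
    ∑ i ∈ range n, x ^ (i + 1) ≤ (1 - x)⁻¹ := by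
  rw [← tsum_geometric_of_lt_one h0 h1]
  refine le_trans (sum_le_sum fun i _ => ?_)
    ((summable_geometric_of_lt_one h0 h1).sum_le_tsum (range n) fun i _ => by positivity)
  exact pow_le_pow_of_le_one h0 h1.le (Nat.le_succ i)

/-- With x = ‖q‖, each factor is at most exp(x^i) and its inverse at most exp(x^i / (1 - x)), by 1 +
u ≤ exp u; the exponents are then summed as a geometric series. -/
lemma exists_qPoch_bound {q : ℂ} (h1 : ‖q‖ < 1) :
    ∃ C : ℝ, 1 ≤ C ∧ ∀ n, ‖qPoch q q n‖ ≤ C ∧ ‖(qPoch q q n)⁻¹‖ ≤ C := by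
  set x := ‖q‖ with hx
  have h0 : 0 ≤ x := norm_nonneg q
  have hd : 0 < 1 - x := by linarith
  have key : ∀ n, ‖qPoch q q n‖ ≤ Real.exp (∑ i ∈ range n, x ^ (i + 1)) ∧
      ‖(qPoch q q n)⁻¹‖ ≤ Real.exp ((∑ i ∈ range n, x ^ (i + 1)) * (1 - x)⁻¹) := by
    intro n
    induction n with
    | zero => simp [qPoch_zero]
    | succ n ih =>
      have hxn : x ^ (n + 1) ≤ x := by
        simpa using pow_le_pow_of_le_one h0 h1.le (Nat.succ_le_succ (Nat.zero_le n))
      have hxn0 : 0 ≤ x ^ (n + 1) := by positivity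
      have hup : ‖1 - q ^ (n + 1)‖ ≤ Real.exp (x ^ (n + 1)) := by
        refine (norm_sub_le _ _).trans ?_
        rw [norm_one, norm_pow]
        linarith [Real.add_one_le_exp (x ^ (n + 1))]
      have hlow : 1 - x ^ (n + 1) ≤ ‖1 - q ^ (n + 1)‖ := by
        have := norm_sub_norm_le (1 : ℂ) (q ^ (n + 1))
        rwa [norm_one, norm_pow] at this
      have hinv : ‖(1 - q ^ (n + 1))⁻¹‖ ≤ Real.exp (x ^ (n + 1) * (1 - x)⁻¹) := by
        rw [norm_inv]
        have hp : 0 < 1 - x ^ (n + 1) := by linarith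
        calc ‖1 - q ^ (n + 1)‖⁻¹ ≤ (1 - x ^ (n + 1))⁻¹ := inv_anti₀ hp hlow
          _ = x ^ (n + 1) * (1 - x ^ (n + 1))⁻¹ + 1 := by field_simp; ring
          _ ≤ x ^ (n + 1) * (1 - x)⁻¹ + 1 := by
            have : (1 - x ^ (n + 1))⁻¹ ≤ (1 - x)⁻¹ := inv_anti₀ hd (by linarith)
            gcongr
          _ ≤ _ := Real.add_one_le_exp _
      rw [qPoch_self_succ, sum_range_succ, add_mul, Real.exp_add, Real.exp_add, mul_inv,
        norm_mul, norm_mul]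
      exact ⟨by gcongr; exact ih.1, by gcongr; exact ih.2⟩
  have hs := sum_range_pow_succ_le h0 h1
  refine ⟨max (Real.exp (1 - x)⁻¹) (Real.exp ((1 - x)⁻¹ * (1 - x)⁻¹)), ?_, fun n => ⟨?_, ?_⟩⟩
  · exact le_max_of_le_left (Real.one_le_exp (by positivity))
  · exact (key n).1.trans (le_max_of_le_left (Real.exp_le_exp.mpr (hs n)))
  · refine (key n).2.trans (le_max_of_le_right (Real.exp_le_exp.mpr ?_))
    exact mul_le_mul_of_nonneg_right (hs n) (by positivity)

lemma qPoch_inv {q : ℂ} (h0 : q ≠ 0) (n : ℕ) :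
    qPoch q⁻¹ q⁻¹ n = (-1) ^ n * (q ^ tri n)⁻¹ * qPoch q q n := by
  induction n with
  | zero => simp [qPoch_zero, tri_zero]
  | succ n ih =>
    rw [qPoch_self_succ, qPoch_self_succ, ih, tri_succ, inv_pow]
    field_simp
    ring

lemma qBinom_add (q : ℂ) (k j : ℕ) :
    qBinom q (k + j) j = qPoch q q (k + j) / (qPoch q q j * qPoch q q k) := by
  simp [qBinom]

lemma qBinom_inv_add {q : ℂ} (h0 : q ≠ 0) (h1 : ‖q‖ < 1) (k l : ℕ) :
    qBinom q⁻¹ (k + l) l = (q ^ (k * l))⁻¹ * qBinom q (k + l) l := by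
  have := qPoch_ne_zero h1 l
  have := qPoch_ne_zero h1 k
  rw [qBinom_add, qBinom_add, qPoch_inv h0, qPoch_inv h0, qPoch_inv h0, tri_add]
  field_simp
  ring

lemma norm_qBinom_add_le {q : ℂ} {C : ℝ}
    (hC : ∀ n, ‖qPoch q q n‖ ≤ C ∧ ‖(qPoch q q n)⁻¹‖ ≤ C) (k j : ℕ) :
    ‖qBinom q (k + j) j‖ ≤ C * (C * C) := by
  have hC0 : 0 ≤ C := (norm_nonneg _).trans (hC 0).1
  rw [qBinom_add, div_eq_mul_inv, mul_inv, norm_mul, norm_mul]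
  gcongr
  exacts [(hC _).1, (hC _).2, (hC _).2]

/-! ### Elementary summation -/

lemma hasSum_sub_succ {G : ℕ → ℂ} (h : Summable G) :
    HasSum (fun t => G t - G (t + 1)) (G 0) := by
  have h2 := (hasSum_nat_add_iff' 1).mpr h.hasSum
  simpa using h.hasSum.sub h2

lemma hasSum_sum_antidiagonal {f : ℕ × ℕ → ℂ} (hf : Summable f) :
    HasSum (fun n => ∑ p ∈ antidiagonal n, f p) (∑' p, f p) := by
  have h := (HasAntidiagonal.sigmaAntidiagonalEquivProd (A := ℕ)).hasSum_iff.mpr hf.hasSum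
  refine h.sigma fun n => ?_
  rw [← sum_coe_sort]
  exact hasSum_fintype fun p : antidiagonal n => f p

lemma summable_of_norm_le_pow {x : ℝ} (h0 : 0 ≤ x) (h1 : x < 1) {u : ℕ → ℂ} {K : ℝ}
    (h : ∀ t, ‖u t‖ ≤ K * x ^ t) : Summable u :=
  .of_norm_bounded ((summable_geometric_of_lt_one h0 h1).mul_left K) h

lemma summable_of_norm_le_pow_mul_pow {x : ℝ} (h0 : 0 ≤ x) (h1 : x < 1) {u : ℕ × ℕ → ℂ} {K : ℝ}
    (h : ∀ p, ‖u p‖ ≤ K * (x ^ p.1 * x ^ p.2)) : Summable u := by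
  have hg := summable_geometric_of_lt_one h0 h1
  refine .of_norm_bounded ((hg.mul_of_nonneg hg ?_ ?_).mul_left K) h <;>
    exact fun n => pow_nonneg h0 n

lemma summable_of_norm_le_pow_mul_pow_mul_pow {x : ℝ} (h0 : 0 ≤ x) (h1 : x < 1)
    {u : ℕ × ℕ × ℕ → ℂ} {K : ℝ}
    (h : ∀ p, ‖u p‖ ≤ K * (x ^ p.1 * (x ^ p.2.1 * x ^ p.2.2))) : Summable u := by
  have hg := summable_geometric_of_lt_one h0 h1
  have hp : (0 : ℕ → ℝ) ≤ fun n => x ^ n := fun n => pow_nonneg h0 n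
  refine .of_norm_bounded ((hg.mul_of_nonneg (hg.mul_of_nonneg hg hp hp) hp ?_).mul_left K) h
  exact fun p => mul_nonneg (pow_nonneg h0 _) (pow_nonneg h0 _)

/-! ### The two basic summation formulas -/

/-- A limiting case of the terminating very well poised `₆φ₅` summation. -/
lemma sum_bailey {q : ℂ} (h1 : ‖q‖ < 1) (d r : ℕ) :
    ∑ s ∈ range (r + 1), (-1) ^ s * q ^ (tri s + s ^ 2 + d * s) * (1 - q ^ (d + 1 + 2 * s)) *
      qPoch q q (d + s) / (qPoch q q s * qPoch q q (r - s) * qPoch q q (d + 1 + r + s)) =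
      (qPoch q q r)⁻¹ := by
  set P := qPoch q q with hP
  have hne : ∀ n, P n ≠ 0 := qPoch_ne_zero h1
  have hs : ∀ n, P (n + 1) = P n * (1 - q ^ (n + 1)) := qPoch_self_succ q
  have hne1 : ∀ n, 1 - q ^ (n + 1) ≠ 0 := one_sub_pow_succ_ne_zero h1
  set f : ℕ → ℕ → ℂ := fun r s => (-1) ^ s * q ^ (tri s + s ^ 2 + d * s) *
    (1 - q ^ (d + 1 + 2 * s)) * P (d + s) / (P s * P (r - s) * P (d + 1 + r + s)) with hf
  -- Telescoping certificate: (1 - q^(r+1)) f(r+1, s) - f(r, s) = G(r, s) - G(r, s+1) for s ≤ r,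
  -- with G(r, 0) = 0.
  set G : ℕ → ℕ → ℂ := fun r s => (-1) ^ s * q ^ (tri s + s ^ 2 + d * s) * q ^ (r + 1 - s) *
    P (d + s) * (1 - q ^ s) / (P s * P (r + 1 - s) * P (d + 1 + r + s)) with hG
  have tel : ∀ r n, n ≤ r + 1 →
      ∑ s ∈ range n, ((1 - q ^ (r + 1)) * f (r + 1) s - f r s) = - G r n := by
    intro r n
    induction n with
    | zero => simp [hG]
    | succ s ih =>
      intro hn
      obtain ⟨t, rfl⟩ : ∃ t, r = s + t := ⟨r - s, by omega⟩
      rw [sum_range_succ, ih (by omega)]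
      simp only [hf, hG]
      rw [show s + t + 1 - s = t + 1 by omega, show s + t - s = t by omega,
        show s + t + 1 - (s + 1) = t by omega,
        show d + 1 + (s + t + 1) + s = d + 1 + (s + t) + s + 1 by ring,
        show d + 1 + (s + t) + (s + 1) = d + 1 + (s + t) + s + 1 by ring,
        show d + (s + 1) = d + s + 1 by ring, hs t, hs s, hs (d + s), hs, tri_succ]
      have e1 := hne t
      have e2 := hne s
      have e3 := hne (d + 1 + (s + t) + s)
      have e4 := hne1 t
      have e5 := hne1 s
      have e6 := hne1 (d + 1 + (s + t) + s)
      field_simp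
      ring
  induction r with
  | zero =>
    have e1 := hne d
    have e2 := hne1 d
    have h00 : P 0 = 1 := qPoch_zero q q
    simp only [zero_add, range_one, sum_singleton, tri_zero]
    simp [h00, hs]
    field_simp
  | succ r ih =>
    have ht := tel r (r + 1) le_rfl
    rw [sum_sub_distrib, ← mul_sum] at ht
    change ∑ s ∈ range (r + 1), f r s = _ at ih
    change ∑ s ∈ range (r + 1 + 1), f (r + 1) s = _
    rw [ih] at ht
    -- The term s = r + 1 lies outside the telescoping range: there truncated subtraction would keep
    -- `f r (r + 1)` from vanishing. It cancels the boundary term of `tel`.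
    have hlast : (1 - q ^ (r + 1)) * f (r + 1) (r + 1) = G r (r + 1) := by
      simp only [hf, hG]
      rw [show d + 1 + (r + 1) + (r + 1) = d + 1 + r + (r + 1) + 1 by ring, hs (d + 1 + r + (r + 1))]
      have e6 := hne1 (d + 1 + r + (r + 1))
      rw [show d + 1 + r + (r + 1) + 1 = d + 1 + 2 * (r + 1) by ring] at e6 ⊢
      have e2 := hne (r + 1)
      have e3 := hne (d + 1 + r + (r + 1))
      have h00 : P 0 = 1 := qPoch_zero q q
      simp only [Nat.sub_self, h00]
      field_simp
    have e1 := hne r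
    have e2 := hne1 r
    apply mul_left_cancel₀ e2
    rw [sum_range_succ, mul_add, hlast, hs]
    field_simp
    field_simp at ht
    linear_combination ht

/-- The summation of `₁φ₁(a; c; q, c/a)` at integral powers of `q`. -/
lemma hasSum_one_phi_one {q : ℂ} (h1 : ‖q‖ < 1) (e i : ℕ) :
    HasSum (fun t => (-1) ^ t * q ^ (tri t + e * t) * qPoch q q (i + t) /
      (qPoch q q t * qPoch q q (i + e + 1 + t))) (qPoch q q i / qPoch q q e) := by
  obtain ⟨C, hC1, hC⟩ := exists_qPoch_bound h1
  have hC0 : 0 ≤ C := by linarith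
  set P := qPoch q q with hP
  have hne : ∀ n, P n ≠ 0 := qPoch_ne_zero h1
  have hs : ∀ n, P (n + 1) = P n * (1 - q ^ (n + 1)) := qPoch_self_succ q
  have hne1 : ∀ n, 1 - q ^ (n + 1) ≠ 0 := one_sub_pow_succ_ne_zero h1
  have hpow : ∀ t, ‖q‖ ^ (tri t + e * t) ≤ ‖q‖ ^ t := fun t =>
    pow_le_pow_of_le_one (norm_nonneg _) h1.le ((le_tri t).trans (Nat.le_add_right _ _))
  induction i with
  | zero =>
    have hsum : Summable fun t => (-1) ^ t * q ^ (tri t + e * t) / P (e + t) := by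
      refine summable_of_norm_le_pow (norm_nonneg q) h1 (K := C) fun t => ?_
      rw [div_eq_mul_inv, norm_mul, norm_mul, norm_pow, norm_pow, norm_neg, norm_one, one_pow,
        one_mul, mul_comm]
      exact mul_le_mul (hC _).2 (hpow t) (by positivity) hC0
    -- For i = 0 the factor (q;q)_t cancels and the summand itself telescopes.
    have h := hasSum_sub_succ hsum
    have h00 : P 0 = 1 := qPoch_zero q q
    simp only [add_zero, mul_zero, tri_zero, pow_zero, one_mul] at h
    rw [h00]
    refine h.congr_fun ?_
    intro t
    rw [zero_add, zero_add, show e + (t + 1) = e + t + 1 by ring,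
      show e + 1 + t = e + t + 1 by ring, hs, tri_succ]
    have e1 := hne t
    have e2 := hne (e + t)
    have e3 := hne1 (e + t)
    field_simp
    ring
  | succ i ih =>
    -- Certificate for the step in i: the new summand is (1 - q^(i+1)) times the old one plus G(t) -
    -- G(t+1). The factor 1 - q^t gives G(0) = 0, so the correction sums to zero.
    set G : ℕ → ℂ := fun t => q ^ (i + 1) * (1 - q ^ t) * ((-1) ^ t * q ^ (tri t + e * t)) *
      P (i + t) * ((P t)⁻¹ * (P (i + e + 1 + t))⁻¹) with hG
    have hsum : Summable G := by
      refine summable_of_norm_le_pow (norm_nonneg q) h1 (K := 1 * 2 * C * (C * C)) fun t => ?_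
      have ha : ‖q ^ (i + 1)‖ ≤ 1 := by
        rw [norm_pow]; exact pow_le_one₀ (norm_nonneg _) h1.le
      have hb : ‖1 - q ^ t‖ ≤ 2 := norm_one_sub_pow_le h1 t
      have hc : ‖(-1) ^ t * q ^ (tri t + e * t)‖ ≤ ‖q‖ ^ t := by
        rw [norm_mul, norm_pow, norm_pow, norm_neg, norm_one, one_pow, one_mul]
        exact hpow t
      calc ‖G t‖ = ‖q ^ (i + 1)‖ * ‖1 - q ^ t‖ * ‖(-1) ^ t * q ^ (tri t + e * t)‖ * ‖P (i + t)‖ *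
            (‖(P t)⁻¹‖ * ‖(P (i + e + 1 + t))⁻¹‖) := by simp only [hG, norm_mul]
        _ ≤ 1 * 2 * ‖q‖ ^ t * C * (C * C) := by
            gcongr
            exacts [(hC _).1, (hC _).2, (hC _).2]
        _ = _ := by ring
    have h := (ih.mul_left (1 - q ^ (i + 1))).add (hasSum_sub_succ hsum)
    have hG0 : G 0 = 0 := by simp [hG]
    rw [hG0, add_zero] at h
    rw [hs, show P i * (1 - q ^ (i + 1)) / P e = (1 - q ^ (i + 1)) * (P i / P e) by ring]
    refine h.congr_fun ?_
    intro t
    simp only [hG]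
    rw [show i + 1 + t = i + t + 1 by ring, show i + (t + 1) = i + t + 1 by ring,
      show i + e + 1 + (t + 1) = i + e + 1 + t + 1 by ring,
      show i + 1 + e + 1 + t = i + e + 1 + t + 1 by ring, hs, hs, hs, tri_succ]
    have e1 := hne t
    have e2 := hne (i + e + 1 + t)
    have e3 := hne1 (i + e + 1 + t)
    have e4 := hne1 t
    field_simp
    ring

/-- A limiting case of Watson's transformation of a very well poised `₈φ₇` series. -/
lemma tsum_watson {q : ℂ} (h1 : ‖q‖ < 1) (k : ℕ) :
    ∑' s, q ^ (2 * s ^ 2 + s + 3 * k * s) * (1 - q ^ (2 * k + 1 + 2 * s)) *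
      qPoch q q (2 * k + s) / qPoch q q s =
    ∑' r, (-1) ^ r * q ^ (tri r + k * r) * qPoch q q (k + r) / qPoch q q r := by
  obtain ⟨C, hC1, hC⟩ := exists_qPoch_bound h1
  have hC0 : 0 ≤ C := by linarith
  set A : ℕ → ℂ := fun s => (-1) ^ s * q ^ (tri s + s ^ 2 + 2 * k * s) *
    (1 - q ^ (2 * k + 1 + 2 * s)) * qPoch q q (2 * k + s) * (qPoch q q s)⁻¹ with hA
  set g : ℕ → ℂ := fun r => (-1) ^ r * q ^ (tri r + k * r) * qPoch q q (k + r) with hg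
  set H : ℕ × ℕ → ℂ := fun p => A p.1 * g (p.1 + p.2) *
    ((qPoch q q p.2)⁻¹ * (qPoch q q (2 * k + 1 + 2 * p.1 + p.2))⁻¹) with hH
  have hAb : ∀ s, ‖A s‖ ≤ ‖q‖ ^ s * 2 * C * C := by
    intro s
    simp only [hA, norm_mul, norm_pow, norm_neg, norm_one, one_pow, one_mul]
    gcongr ?_ * ?_ * ?_ * ?_
    · exact pow_le_pow_of_le_one (norm_nonneg _) h1.le 
        ((le_tri s).trans ((Nat.le_add_right _ _).trans (Nat.le_add_right _ _)))
    · exact norm_one_sub_pow_le h1 _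
    · exact (hC _).1
    · exact (hC _).2
  have hgb : ∀ s t, ‖g (s + t)‖ ≤ ‖q‖ ^ t * C := by
    intro s t
    simp only [hg, norm_mul, norm_pow, norm_neg, norm_one, one_pow, one_mul]
    gcongr ?_ * ?_
    · exact pow_le_pow_of_le_one (norm_nonneg _) h1.le 
        (((Nat.le_add_left t s).trans (le_tri _)).trans (Nat.le_add_right _ _))
    · exact (hC _).1
  have hHs : Summable H := by
    refine summable_of_norm_le_pow_mul_pow (norm_nonneg q) h1
      (K := 2 * C * C * C * (C * C)) fun p => ?_
    refine (norm_mul_le_of_le (norm_mul_le_of_le (hAb p.1) (hgb p.1 p.2))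
      (norm_mul_le_of_le (hC p.2).2 (hC _).2)).trans_eq ?_
    ring
  have hright := (hasSum_sum_antidiagonal hHs).tsum_eq
  have hleft := hHs.tsum_prod
  rw [← hright] at hleft
  refine Eq.trans ?_ (hleft.symm.trans ?_)
  · refine tsum_congr fun s => ?_
    -- Both parameters equal k + s, so the inner sum over t = r - s has the ratio of equal
    -- Pochhammer symbols as its value, namely 1.
    have hph := (hasSum_one_phi_one h1 (k + s) (k + s)).mul_left
      (A s * ((-1) ^ s * q ^ (tri s + k * s)))
    rw [div_self (qPoch_ne_zero h1 _), mul_one] at hph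
    have : ∀ t, H (s, t) = A s * ((-1) ^ s * q ^ (tri s + k * s)) *
        ((-1) ^ t * q ^ (tri t + (k + s) * t) * qPoch q q (k + s + t) /
          (qPoch q q t * qPoch q q (k + s + (k + s) + 1 + t))) := by
      intro t
      simp only [hH, hg]
      rw [tri_add, show k + s + (k + s) + 1 + t = 2 * k + 1 + 2 * s + t by ring,
        ← add_assoc k s t]
      ring
    rw [tsum_congr this, hph.tsum_eq]
    simp only [hA]
    have hsg : ((-1 : ℂ) ^ s) * (-1) ^ s = 1 := by rw [← mul_pow]; simp
    have hexp : q ^ (2 * s ^ 2 + s + 3 * k * s) =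
        q ^ (tri s + s ^ 2 + 2 * k * s) * q ^ (tri s + k * s) := by
      rw [← pow_add]
      congr 1
      linarith [two_mul_tri s]
    rw [hexp, div_eq_mul_inv]
    linear_combination (-(q ^ (tri s + s ^ 2 + 2 * k * s) * q ^ (tri s + k * s) *
      (1 - q ^ (2 * k + 1 + 2 * s)) * qPoch q q (2 * k + s) * (qPoch q q s)⁻¹)) * hsg
  · refine tsum_congr fun r => ?_
    rw [div_eq_mul_inv, ← sum_bailey h1 (2 * k) r, mul_sum,
      Nat.sum_antidiagonal_eq_sum_range_succ_mk]
    refine sum_congr rfl fun s hs => ?_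
    have hsr : s ≤ r := Nat.lt_succ_iff.mp (mem_range.mp hs)
    simp only [hH, hA, hg]
    rw [Nat.add_sub_cancel' hsr, show 2 * k + 1 + 2 * s + (r - s) = 2 * k + 1 + r + s by omega]
    simp only [div_eq_mul_inv, mul_inv]
    ring

/-! ### Products of `q`-binomial series -/

/-- The power series `∑ j, [n + j, j]_q (y X) ^ j`, the inverse of `∏ i ≤ n, (1 - y q ^ i X)`. -/
noncomputable def binomSeries (q : ℂ) (n : ℕ) (y : ℂ) : PowerSeries ℂ :=
  PowerSeries.mk fun j => y ^ j * qBinom q (n + j) j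

/-- The linear factor `1 - c X`. -/
noncomputable def linFactor (c : ℂ) : PowerSeries ℂ := 1 - PowerSeries.C c * PowerSeries.X

lemma coeff_zero_mul_linFactor (f : PowerSeries ℂ) (c : ℂ) :
    PowerSeries.coeff 0 (f * linFactor c) = PowerSeries.coeff 0 f := by
  simp [linFactor]

lemma coeff_succ_mul_linFactor (f : PowerSeries ℂ) (c : ℂ) (n : ℕ) :
    PowerSeries.coeff (n + 1) (f * linFactor c) =
      PowerSeries.coeff (n + 1) f - c * PowerSeries.coeff n f := by
  rw [linFactor, mul_sub, mul_one, ← mul_assoc, mul_comm f, mul_assoc, map_sub,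
    PowerSeries.coeff_C_mul, PowerSeries.coeff_succ_mul_X]

lemma qBinom_zero_right {q : ℂ} (h1 : ‖q‖ < 1) (n : ℕ) : qBinom q n 0 = 1 := by
  simp [qBinom, qPoch_zero, qPoch_ne_zero h1]

lemma binomSeries_zero_mul {q : ℂ} (h1 : ‖q‖ < 1) (y : ℂ) :
    binomSeries q 0 y * linFactor y = 1 := by
  have hb : ∀ j, qBinom q (0 + j) j = 1 := fun j => by
    rw [qBinom_add, qPoch_zero, zero_add, mul_one, div_self (qPoch_ne_zero h1 j)]
  ext n
  cases n with
  | zero => rw [coeff_zero_mul_linFactor]; simp [binomSeries, qBinom_zero_right h1]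
  | succ n =>
    rw [coeff_succ_mul_linFactor]
    simp only [binomSeries, PowerSeries.coeff_mk, hb, PowerSeries.coeff_one]
    simp; ring

lemma binomSeries_succ_mul {q : ℂ} (h1 : ‖q‖ < 1) (n : ℕ) (y : ℂ) :
    binomSeries q (n + 1) y * linFactor (y * q ^ (n + 1)) = binomSeries q n y := by
  ext j
  cases j with
  | zero =>
    rw [coeff_zero_mul_linFactor]
    simp [binomSeries, qBinom_zero_right h1]
  | succ j =>
    rw [coeff_succ_mul_linFactor]
    simp only [binomSeries, PowerSeries.coeff_mk, qBinom_add]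
    rw [show n + 1 + (j + 1) = n + 1 + j + 1 by ring, show n + (j + 1) = n + 1 + j by ring,
      qPoch_self_succ, qPoch_self_succ, qPoch_self_succ]
    have e1 := qPoch_ne_zero h1 j
    have e2 := qPoch_ne_zero h1 n
    have e3 := one_sub_pow_succ_ne_zero h1 j
    have e4 := one_sub_pow_succ_ne_zero h1 n
    field_simp
    ring

lemma binomSeries_mul_prod {q : ℂ} (h1 : ‖q‖ < 1) (n : ℕ) (y : ℂ) :
    binomSeries q n y * ∏ i ∈ range (n + 1), linFactor (y * q ^ i) = 1 := by
  induction n with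
  | zero => simpa using binomSeries_zero_mul h1 y
  | succ n ih =>
    rw [prod_range_succ, mul_comm (∏ i ∈ range (n + 1), _), ← mul_assoc,
      binomSeries_succ_mul h1, ih]

/-- The two reciprocal products have roots indexed by the powers q^0, …, q^k and q^(-k), …, q^0.
Only q^0 is repeated, and `linFactor 1` removes the repetition, leaving the 2k + 1 consecutive
powers from q^(-k). -/
lemma binomSeries_mul_binomSeries {q : ℂ} (h0 : q ≠ 0) (h1 : ‖q‖ < 1) (k : ℕ) :
    binomSeries q k 1 * binomSeries q k (q ^ k)⁻¹ * linFactor 1 =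
      binomSeries q (2 * k) (q ^ k)⁻¹ := by
  have ha := binomSeries_mul_prod h1 k 1
  have hb := binomSeries_mul_prod h1 k (q ^ k)⁻¹
  have hc := binomSeries_mul_prod h1 (2 * k) (q ^ k)⁻¹
  rw [show 2 * k + 1 = k + 1 + k by ring, prod_range_add] at hc
  rw [prod_range_succ'] at ha
  have hshift : ∏ i ∈ range k, linFactor ((q ^ k)⁻¹ * q ^ (k + 1 + i)) =
      ∏ i ∈ range k, linFactor (1 * q ^ (i + 1)) := by
    refine prod_congr rfl fun i _ => ?_
    congr 1
    rw [show k + 1 + i = k + (i + 1) by ring, pow_add]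
    field_simp
  rw [hshift] at hc
  rw [pow_zero, mul_one] at ha
  set U := ∏ i ∈ range k, linFactor (1 * q ^ (i + 1))
  set V := ∏ i ∈ range (k + 1), linFactor ((q ^ k)⁻¹ * q ^ i)
  set D := binomSeries q (2 * k) (q ^ k)⁻¹
  linear_combination D * ha + (binomSeries q k 1 * U * linFactor 1) * D * hb
    - (binomSeries q k 1 * binomSeries q k (q ^ k)⁻¹ * linFactor 1) * hc

/-- The coefficient `∑_{j + l = s} [k + j, j]_q [k + l, l]_{q⁻¹}`. -/
noncomputable def binomConv (q : ℂ) (k s : ℕ) : ℂ :=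
  ∑ p ∈ antidiagonal s, qBinom q (k + p.1) p.1 * qBinom q⁻¹ (k + p.2) p.2

lemma binomConv_eq_coeff {q : ℂ} (h0 : q ≠ 0) (h1 : ‖q‖ < 1) (k s : ℕ) :
    binomConv q k s = PowerSeries.coeff s (binomSeries q k 1 * binomSeries q k (q ^ k)⁻¹) := by
  rw [binomConv, PowerSeries.coeff_mul]
  refine sum_congr rfl fun p _ => ?_
  simp only [binomSeries, PowerSeries.coeff_mk]
  rw [qBinom_inv_add h0 h1, one_pow, one_mul, pow_mul, inv_pow]

lemma binomConv_zero {q : ℂ} (h0 : q ≠ 0) (h1 : ‖q‖ < 1) (k : ℕ) : binomConv q k 0 = 1 := by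
  rw [binomConv_eq_coeff h0 h1, ← coeff_zero_mul_linFactor _ 1, binomSeries_mul_binomSeries h0 h1]
  simp [binomSeries, qBinom_zero_right h1]

lemma binomConv_succ_sub {q : ℂ} (h0 : q ≠ 0) (h1 : ‖q‖ < 1) (k s : ℕ) :
    binomConv q k (s + 1) - binomConv q k s =
      ((q ^ k)⁻¹) ^ (s + 1) * qBinom q (2 * k + (s + 1)) (s + 1) := by
  have h := coeff_succ_mul_linFactor (binomSeries q k 1 * binomSeries q k (q ^ k)⁻¹) 1 s
  rw [binomSeries_mul_binomSeries h0 h1, one_mul, ← binomConv_eq_coeff h0 h1,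
    ← binomConv_eq_coeff h0 h1] at h
  rw [← h]
  simp [binomSeries]

/-! ### Summability of the triple series -/

/-- The quadratic exponent absorbs the linear term in m and still leaves N for geometric decay;
after bounding m k by |m| N, the constant comes from completing the square. -/
lemma quadratic_lower_bound (m : ℤ) (N k : ℕ) (hk : k ≤ N) :
    (N : ℤ) - ((|m| + 1) ^ 2 + |m|) ≤ N ^ 2 + (-m * k - m) := by
  have h1 : m * k ≤ |m| * N := by
    calc m * (k : ℤ) ≤ |m| * k := by gcongr; exact le_abs_self m
      _ ≤ |m| * N := by gcongr
  have h2 := le_abs_self m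
  nlinarith [sq_nonneg ((N : ℤ) - (|m| + 1)), abs_nonneg m, mul_nonneg (abs_nonneg m)
    (Int.natCast_nonneg N), sq_nonneg ((N : ℤ)), sq_nonneg ((N : ℤ) - 2 * (|m| + 1))]

/-- With N = k + j + l, inverting q in the second binomial costs q^(-kl), and kl ≤ N^2. Half of the
exponent 2 N^2 pays for this; the other half pays for q^(-mk-m) and leaves q^N. -/
lemma summable_weight_mul_qBinom {q : ℂ} (h0 : q ≠ 0) (h1 : ‖q‖ < 1) (m : ℤ) {w : ℕ → ℂ} {K : ℝ}
    (hw : ∀ N, ‖w N‖ ≤ K * ‖q‖ ^ (2 * N ^ 2)) :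
    Summable fun p : ℕ × ℕ × ℕ => w (p.1 + p.2.1 + p.2.2) * qBinom q (p.1 + p.2.1) p.2.1 *
      qBinom q⁻¹ (p.1 + p.2.2) p.2.2 * q ^ (-m * (p.1 : ℤ) - m) := by
  obtain ⟨C, hC1, hC⟩ := exists_qPoch_bound h1
  have hx : 0 < ‖q‖ := norm_pos_iff.mpr h0
  have hK : 0 ≤ K := by simpa using (norm_nonneg _).trans (hw 0)
  set B : ℤ := (|m| + 1) ^ 2 + |m| with hB
  refine summable_of_norm_le_pow_mul_pow_mul_pow hx.le h1
    (K := K * (C * (C * C)) * (C * (C * C)) * ‖q‖ ^ (-B)) ?_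
  rintro ⟨k, j, l⟩
  dsimp only
  rw [qBinom_inv_add h0 h1]
  have hb : ‖(q ^ (k * l))⁻¹‖ ≤ ‖q‖ ^ (-((k * l : ℕ) : ℤ)) := by
    rw [norm_inv, norm_pow, zpow_neg, zpow_natCast]
  have hz : ‖q ^ (-m * (k : ℤ) - m)‖ ≤ ‖q‖ ^ (-m * (k : ℤ) - m) := (norm_zpow _ _).le
  refine (norm_mul_le_of_le (norm_mul_le_of_le (norm_mul_le_of_le (hw (k + j + l))
    (norm_qBinom_add_le hC k j)) (norm_mul_le_of_le hb (norm_qBinom_add_le hC k l))) hz).trans ?_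
  have hexp : ((k + j + l : ℕ) : ℤ) - B ≤
      ((2 * (k + j + l) ^ 2 : ℕ) : ℤ) + (-((k * l : ℕ) : ℤ)) + (-m * (k : ℤ) - m) := by
    have h := quadratic_lower_bound m (k + j + l) k (by omega)
    have hkl : k * l ≤ (k + j + l) ^ 2 := by
      rw [sq]; exact Nat.mul_le_mul (by omega) (by omega)
    have hkl' : ((k * l : ℕ) : ℤ) ≤ (((k + j + l) ^ 2 : ℕ) : ℤ) := by exact_mod_cast hkl
    push_cast at h hkl' ⊢
    linarith
  have hpow := zpow_le_zpow_right_of_le_one₀ hx h1.le hexp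
  rw [zpow_add₀ hx.ne', zpow_add₀ hx.ne', sub_eq_add_neg _ B, zpow_add₀ hx.ne' _ (-B), zpow_natCast,
    zpow_natCast, pow_add, pow_add] at hpow
  calc _ = K * (C * (C * C)) * (C * (C * C)) * (‖q‖ ^ (2 * (k + j + l) ^ 2) *
        ‖q‖ ^ (-((k * l : ℕ) : ℤ)) * ‖q‖ ^ (-m * (k : ℤ) - m)) := by ring
    _ ≤ K * (C * (C * C)) * (C * (C * C)) * (‖q‖ ^ k * ‖q‖ ^ j * ‖q‖ ^ l * ‖q‖ ^ (-B)) := by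
        have hC0 : 0 ≤ C := by linarith
        exact mul_le_mul_of_nonneg_left hpow (by positivity)
    _ = _ := by ring

/-! ### The identity for fixed `k` -/

/-- The difference `q ^ T(2N) - q ^ T(2N + 1)`, where `T(n) = n (n + 1) / 2`. -/
noncomputable def thetaDiff (q : ℂ) (N : ℕ) : ℂ :=
  q ^ (N * (2 * N + 1)) - q ^ ((2 * N + 1) * (N + 1))

lemma norm_thetaDiff_le {q : ℂ} (h1 : ‖q‖ < 1) (N : ℕ) :
    ‖thetaDiff q N‖ ≤ 2 * ‖q‖ ^ (2 * N ^ 2) := by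
  have ha : ‖q‖ ^ (N * (2 * N + 1)) ≤ ‖q‖ ^ (2 * N ^ 2) :=
    pow_le_pow_of_le_one (norm_nonneg _) h1.le (by nlinarith)
  have hb : ‖q‖ ^ ((2 * N + 1) * (N + 1)) ≤ ‖q‖ ^ (2 * N ^ 2) :=
    pow_le_pow_of_le_one (norm_nonneg _) h1.le (by nlinarith)
  refine (norm_sub_le _ _).trans ?_
  rw [norm_pow, norm_pow]
  linarith

lemma norm_thetaDiff_succ_le {q : ℂ} (h1 : ‖q‖ < 1) (N : ℕ) :
    ‖thetaDiff q (N + 1)‖ ≤ 2 * ‖q‖ ^ (2 * N ^ 2) := by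
  refine (norm_thetaDiff_le h1 (N + 1)).trans ?_
  gcongr 2 * ?_
  exact pow_le_pow_of_le_one (norm_nonneg _) h1.le (by gcongr; omega)

/-- Regrouping along j + l = s; the existential `σ` names the common value so that summation by
parts can be done with `HasSum` alone. -/
lemma hasSum_weight_mul_binomConv {q : ℂ} (h0 : q ≠ 0) (h1 : ‖q‖ < 1) (k : ℕ) {w : ℕ → ℂ}
    {K : ℝ} (hw : ∀ N, ‖w N‖ ≤ K * ‖q‖ ^ (2 * N ^ 2)) :
    ∃ σ, HasSum (fun p : ℕ × ℕ => w (k + p.1 + p.2) * qBinom q (k + p.1) p.1 *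
      qBinom q⁻¹ (k + p.2) p.2) σ ∧ HasSum (fun s => w (k + s) * binomConv q k s) σ := by
  have h := (summable_weight_mul_qBinom h0 h1 0 hw).comp_injective
    (i := fun p : ℕ × ℕ => (k, p)) (fun a b hab => by simpa using hab)
  have h' : Summable fun p : ℕ × ℕ => w (k + p.1 + p.2) * qBinom q (k + p.1) p.1 *
      qBinom q⁻¹ (k + p.2) p.2 := by
    simpa [Function.comp_def] using h
  refine ⟨_, h'.hasSum, (hasSum_sum_antidiagonal h').congr_fun fun s => ?_⟩
  rw [binomConv, mul_sum]
  refine sum_congr rfl fun p hp => ?_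
  rw [add_assoc k, mem_antidiagonal.mp hp, mul_assoc]

lemma tsum_surgery_fiber {q : ℂ} (h0 : q ≠ 0) (h1 : ‖q‖ < 1) (k : ℕ) :
    ∑' p : ℕ × ℕ, (thetaDiff q (k + p.1 + p.2) - thetaDiff q (k + p.1 + p.2 + 1)) *
      qBinom q (k + p.1) p.1 * qBinom q⁻¹ (k + p.2) p.2 =
    ∑' r, (-1) ^ r * q ^ (2 * k ^ 2 + k + k * r + tri r) * qPoch q q (k + r) /
      (qPoch q q (2 * k) * qPoch q q r) := by
  obtain ⟨σ, hσ, hσ'⟩ := hasSum_weight_mul_binomConv h0 h1 k (norm_thetaDiff_le h1)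
  obtain ⟨υ, hυ, hυ'⟩ := hasSum_weight_mul_binomConv h0 h1 k (norm_thetaDiff_succ_le h1)
  set D : ℕ → ℂ := fun s => thetaDiff q (k + s) * (((q ^ k)⁻¹) ^ s * qBinom q (2 * k + s) s)
    with hD
  have hleft : HasSum (fun p : ℕ × ℕ =>
      (thetaDiff q (k + p.1 + p.2) - thetaDiff q (k + p.1 + p.2 + 1)) *
        qBinom q (k + p.1) p.1 * qBinom q⁻¹ (k + p.2) p.2) (σ - υ) :=
    (hσ.sub hυ).congr_fun fun p => by ring
  -- Summation by parts: shift the series of w(k+s) c_s by one, so that c_(s+1) - c_s appears; the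
  -- boundary term is D(0), since c_0 = 1.
  have hDsum : HasSum D (σ - υ) := by
    rw [← hasSum_nat_add_iff' 1]
    have hshift := ((hasSum_nat_add_iff' 1).mpr hσ').sub hυ'
    have hD0 : D 0 = thetaDiff q (k + 0) * binomConv q k 0 := by
      simp [hD, binomConv_zero h0 h1, qBinom_zero_right h1]
    rw [sum_range_one, hD0]
    rw [sum_range_one, sub_right_comm] at hshift
    refine hshift.congr_fun fun s => ?_
    simp only [hD]
    rw [← binomConv_succ_sub h0 h1, add_assoc k s 1]
    ring
  rw [hleft.tsum_eq, ← hDsum.tsum_eq]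
  have hP := qPoch_ne_zero h1 (2 * k)
  calc ∑' s, D s = ∑' s, q ^ (2 * k ^ 2 + k) / qPoch q q (2 * k) *
        (q ^ (2 * s ^ 2 + s + 3 * k * s) * (1 - q ^ (2 * k + 1 + 2 * s)) *
          qPoch q q (2 * k + s) / qPoch q q s) := by
        refine tsum_congr fun s => ?_
        simp only [hD, thetaDiff, qBinom_add]
        have e1 := qPoch_ne_zero h1 s
        rw [show (k + s) * (2 * (k + s) + 1) =
            2 * k ^ 2 + k + (2 * s ^ 2 + s + 3 * k * s) + k * s by ring,
          show (2 * (k + s) + 1) * (k + s + 1) =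
            2 * k ^ 2 + k + (2 * s ^ 2 + s + 3 * k * s) + k * s + (2 * k + 1 + 2 * s) by ring,
          inv_pow, ← pow_mul, pow_add _ (2 * k ^ 2 + k + (2 * s ^ 2 + s + 3 * k * s) + k * s),
          pow_add _ _ (k * s), pow_add _ (2 * k ^ 2 + k)]
        have e2 : q ^ (k * s) ≠ 0 := pow_ne_zero _ h0
        generalize q ^ (k * s) = u at *
        generalize q ^ (2 * k ^ 2 + k) = v at *
        generalize q ^ (2 * s ^ 2 + s + 3 * k * s) = z at *
        field_simp
    _ = ∑' r, q ^ (2 * k ^ 2 + k) / qPoch q q (2 * k) *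
        ((-1) ^ r * q ^ (tri r + k * r) * qPoch q q (k + r) / qPoch q q r) := by
        rw [tsum_mul_left, tsum_mul_left, tsum_watson h1]
    _ = _ := by
        refine tsum_congr fun r => ?_
        rw [show 2 * k ^ 2 + k + k * r + tri r = (2 * k ^ 2 + k) + (tri r + k * r) by ring,
          pow_add _ (2 * k ^ 2 + k)]
        simp only [div_eq_mul_inv, mul_inv]
        ring

/-! ### The series `Z_{m,0}` -/

/-- The parametrization `(k, r) ↦ (-k - 1, -k - r - 1)` of the support of `beta`. -/
def betaIndex (p : ℕ × ℕ) : ℤ × ℤ := (-(p.1 : ℤ) - 1, -(p.1 : ℤ) - p.2 - 1)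

lemma betaIndex_injective : Function.Injective betaIndex := by
  rintro ⟨a, b⟩ ⟨c, d⟩ h
  simp only [betaIndex, Prod.mk.injEq] at h ⊢
  omega

lemma ZTerm_eq_zero (m n : ℤ) (q : ℂ) {p : ℤ × ℤ} (hp : p ∉ Set.range betaIndex) :
    ZTerm m n q p = 0 := by
  obtain ⟨k, l⟩ := p
  have : ¬ (l ≤ k ∧ k ≤ -1) := by
    rintro ⟨hlk, hk⟩
    refine hp ⟨((-k - 1).toNat, (k - l).toNat), ?_⟩
    simp only [betaIndex, Prod.mk.injEq]
    omega
  simp [ZTerm, beta, this]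

lemma ZTerm_betaIndex (m : ℤ) {q : ℂ} (k r : ℕ) :
    ZTerm m 0 q (betaIndex (k, r)) =
      (-1) ^ r * q ^ (2 * k ^ 2 + k + k * r + tri r) * qPoch q q (k + r) /
        (qPoch q q (2 * k) * qPoch q q r) * q ^ (-m * (k : ℤ) - m) := by
  -- The triangular polynomial is invariant under n ↦ -n - 1, which makes both halved products
  -- explicit multiples of two.
  have hexp : 3 * (-(k : ℤ) - 1) * (-(k : ℤ) - 1 + 1) / 2 +
      (-(k : ℤ) - r - 1) * (-(k : ℤ) - r - 1 + 1) / 2 + (-(k : ℤ) - 1) + 1 =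
      ((2 * k ^ 2 + k + k * r + tri r : ℕ) : ℤ) := by
    have h1 := two_mul_tri k
    have h2 := two_mul_tri (k + r)
    have h3 := two_mul_tri r
    zify at h1 h2 h3
    have e1 : 3 * (-(k : ℤ) - 1) * (-(k : ℤ) - 1 + 1) = 3 * tri k * 2 := by linarith
    have e2 : (-(k : ℤ) - r - 1) * (-(k : ℤ) - r - 1 + 1) = tri (k + r) * 2 := by linarith
    rw [e1, e2, Int.mul_ediv_cancel _ two_ne_zero, Int.mul_ediv_cancel _ two_ne_zero]
    push_cast
    linarith
  have hsign : ((-1 : ℂ)) ^ (-(k : ℤ) - 1 + (-(k : ℤ) - r - 1)) = (-1) ^ r := by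
    rw [show -(k : ℤ) - 1 + (-(k : ℤ) - r - 1) = 2 * (-(k : ℤ) - 1 - r) + (r : ℕ) by ring,
      zpow_add₀ (by norm_num), zpow_mul, zpow_natCast]
    norm_num
  have hcond : -(k : ℤ) - r - 1 ≤ -(k : ℤ) - 1 ∧ -(k : ℤ) - 1 ≤ -1 := by omega
  rw [ZTerm, beta, if_pos (by exact hcond)]
  simp only [betaIndex]
  rw [hexp, hsign, zpow_natCast,
    show (-(-(k : ℤ) - r - 1) - 1).toNat = k + r by omega,
    show (-2 * (-(k : ℤ) - 1) - 2).toNat = 2 * k by omega,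
    show (-(k : ℤ) - 1 - (-(k : ℤ) - r - 1)).toNat = r by omega,
    show m * (-(k : ℤ) - 1) + 0 * (-(k : ℤ) - r - 1) = -m * (k : ℤ) - m by ring]

lemma summable_ZTerm_betaIndex {q : ℂ} (h0 : q ≠ 0) (h1 : ‖q‖ < 1) (m : ℤ) :
    Summable fun p => ZTerm m 0 q (betaIndex p) := by
  obtain ⟨C, hC1, hC⟩ := exists_qPoch_bound h1
  have hC0 : 0 ≤ C := by linarith
  have hx : 0 < ‖q‖ := norm_pos_iff.mpr h0
  set B : ℤ := (|m| + 1) ^ 2 + |m| with hB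
  refine summable_of_norm_le_pow_mul_pow hx.le h1 (K := C * (C * C) * ‖q‖ ^ (-B)) ?_
  rintro ⟨k, r⟩
  rw [ZTerm_betaIndex, div_eq_mul_inv, mul_inv]
  have ha : ‖(-1) ^ r * q ^ (2 * k ^ 2 + k + k * r + tri r)‖ ≤
      ‖q‖ ^ (2 * k ^ 2 + k + k * r + tri r) := by simp
  have hz : ‖q ^ (-m * (k : ℤ) - m)‖ ≤ ‖q‖ ^ (-m * (k : ℤ) - m) := (norm_zpow _ _).le
  refine (norm_mul_le_of_le (norm_mul_le_of_le (norm_mul_le_of_le ha (hC _).1)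
    (norm_mul_le_of_le (hC _).2 (hC _).2)) hz).trans ?_
  have hexp : ((k + r : ℕ) : ℤ) - B ≤
      ((2 * k ^ 2 + k + k * r + tri r : ℕ) : ℤ) + (-m * (k : ℤ) - m) := by
    have h := quadratic_lower_bound m k k le_rfl
    have hr : (r : ℤ) ≤ tri r := by exact_mod_cast le_tri r
    push_cast
    nlinarith [Int.natCast_nonneg k, Int.natCast_nonneg (k * r), sq_nonneg (k : ℤ)]
  have hpow := zpow_le_zpow_right_of_le_one₀ hx h1.le hexp
  rw [zpow_add₀ hx.ne', sub_eq_add_neg _ B, zpow_add₀ hx.ne' _ (-B), zpow_natCast,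
    zpow_natCast, pow_add _ k r] at hpow
  calc _ = C * (C * C) * (‖q‖ ^ (2 * k ^ 2 + k + k * r + tri r) * ‖q‖ ^ (-m * (k : ℤ) - m)) := by
        ring
    _ ≤ C * (C * C) * (‖q‖ ^ k * ‖q‖ ^ r * ‖q‖ ^ (-B)) :=
        mul_le_mul_of_nonneg_left hpow (by positivity)
    _ = _ := by ring

lemma summable_ZTerm {q : ℂ} (h0 : q ≠ 0) (h1 : ‖q‖ < 1) (m : ℤ) : Summable (ZTerm m 0 q) :=
  (betaIndex_injective.summable_iff fun _ hp => ZTerm_eq_zero m 0 q hp).mp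
    (summable_ZTerm_betaIndex h0 h1 m)

lemma Z_eq_tsum_betaIndex (m : ℤ) (q : ℂ) : Z m 0 q = ∑' p, ZTerm m 0 q (betaIndex p) := by
  refine (betaIndex_injective.tsum_eq fun p hp => ?_).symm
  by_contra h
  exact hp (ZTerm_eq_zero m 0 q h)

lemma hasSum_surgery {q : ℂ} (h0 : q ≠ 0) (h1 : ‖q‖ < 1) (m : ℤ) :
    HasSum (fun p : ℕ × ℕ × ℕ =>
      (thetaDiff q (p.1 + p.2.1 + p.2.2) - thetaDiff q (p.1 + p.2.1 + p.2.2 + 1)) *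
        qBinom q (p.1 + p.2.1) p.2.1 * qBinom q⁻¹ (p.1 + p.2.2) p.2.2 *
          q ^ (-m * (p.1 : ℤ) - m)) (Z m 0 q) := by
  have hs : Summable (fun p : ℕ × ℕ × ℕ =>
      (thetaDiff q (p.1 + p.2.1 + p.2.2) - thetaDiff q (p.1 + p.2.1 + p.2.2 + 1)) *
        qBinom q (p.1 + p.2.1) p.2.1 * qBinom q⁻¹ (p.1 + p.2.2) p.2.2 *
          q ^ (-m * (p.1 : ℤ) - m)) :=
    summable_weight_mul_qBinom h0 h1 m (w := fun N => thetaDiff q N - thetaDiff q (N + 1))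
      (K := 4) fun N => (norm_sub_le _ _).trans
        (by linarith [norm_thetaDiff_le h1 N, norm_thetaDiff_succ_le h1 N])
  convert hs.hasSum using 1
  rw [Z_eq_tsum_betaIndex, (summable_ZTerm_betaIndex h0 h1 m).tsum_prod, hs.tsum_prod]
  refine tsum_congr fun k => ?_
  simp only [ZTerm_betaIndex]
  rw [tsum_mul_right, tsum_mul_right, tsum_surgery_fiber h0 h1]

/-! ### Rational powers of `q` -/

lemma qpow_add (τ : ℂ) (r s : ℚ) : qpow τ (r + s) = qpow τ r * qpow τ s := by
  rw [qpow, qpow, qpow, ← Complex.exp_add]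
  push_cast
  ring_nf

lemma qpow_natCast (τ : ℂ) (n : ℕ) : qpow τ n = qpow τ 1 ^ n := by
  rw [qpow, qpow, ← Complex.exp_nat_mul]
  push_cast
  ring_nf

lemma qpow_ne_zero (τ : ℂ) (r : ℚ) : qpow τ r ≠ 0 := Complex.exp_ne_zero _

lemma norm_qpow_one_lt_one {τ : ℂ} (hτ : 0 < τ.im) : ‖qpow τ 1‖ < 1 := by
  rw [qpow, Complex.norm_exp, Real.exp_lt_one_iff]
  have : (2 * Real.pi * Complex.I * ((1 : ℚ) : ℂ) * τ).re = -(2 * Real.pi * τ.im) := by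
    simp
  rw [this]
  have := mul_pos Real.two_pi_pos hτ
  linarith

/-- Completing the square: 2(N + 1/4)^2 and 2(N + 3/4)^2 exceed the triangular numbers of 2N and 2N
+ 1 by 1/8; the other two exponents are these at N + 1. -/
lemma thetaTerm_eq (τ : ℂ) (N : ℕ) :
    thetaTerm τ N =
      -qpow τ (1 / 8) * (thetaDiff (qpow τ 1) N - thetaDiff (qpow τ 1) (N + 1)) := by
  have e1 : (2 * ((N : ℚ) + 3 / 4) ^ 2) = 1 / 8 + ((2 * N + 1) * (N + 1) : ℕ) := by
    push_cast; ring
  have e2 : (2 * ((N : ℚ) + 7 / 4) ^ 2) = 1 / 8 + ((2 * (N + 1) + 1) * (N + 1 + 1) : ℕ) := by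
    push_cast; ring
  have e3 : (2 * ((N : ℚ) + 1 / 4) ^ 2) = 1 / 8 + (N * (2 * N + 1) : ℕ) := by
    push_cast; ring
  have e4 : (2 * ((N : ℚ) + 5 / 4) ^ 2) = 1 / 8 + ((N + 1) * (2 * (N + 1) + 1) : ℕ) := by
    push_cast; ring
  rw [thetaTerm, e1, e2, e3, e4]
  simp only [qpow_add, qpow_natCast, thetaDiff]
  ring

lemma hasSum_ZhatTermM {τ : ℂ} (hτ : 0 < τ.im) (m : ℤ) :
    HasSum (ZhatTermM m τ) (-qpow τ (1 / 8) * Z m 0 (qpow τ 1)) := by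
  refine ((hasSum_surgery (qpow_ne_zero τ 1) (norm_qpow_one_lt_one hτ) m).mul_left
    (-qpow τ (1 / 8))).congr_fun fun p => ?_
  rw [ZhatTermM, ZhatTerm, thetaTerm_eq]
  ring

lemma ZhatM_eq {τ : ℂ} (hτ : 0 < τ.im) (m : ℤ) :
    ZhatM m τ = -qpow τ (1 / 2) * Z m 0 (qpow τ 1) := by
  rw [ZhatM, (hasSum_ZhatTermM hτ m).tsum_eq, show (1 / 2 : ℚ) = 3 / 8 + 1 / 8 by norm_num,
    qpow_add]
  ring

lemma ZhatTermM_zero (τ : ℂ) : ZhatTermM 0 τ = ZhatTerm τ := by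
  funext p
  simp [ZhatTermM]

end FigEightSurgery

theorem mainTheorem6 (τ : ℂ) (hτ : 0 < τ.im) :
    (∀ m : ℤ,
      Summable (FigEightSurgery.ZhatTermM m τ) ∧
      Summable (FigEightSurgery.ZTerm m 0 (FigEightSurgery.qpow τ 1)) ∧
      FigEightSurgery.ZhatM m τ =
        -FigEightSurgery.qpow τ (1 / 2) *
          FigEightSurgery.Z m 0 (FigEightSurgery.qpow τ 1)) ∧
    (Summable (FigEightSurgery.ZhatTerm τ) ∧
      FigEightSurgery.Zhat τ =
        -FigEightSurgery.qpow τ (1 / 2) *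
          FigEightSurgery.Z 0 0 (FigEightSurgery.qpow τ 1)) := by
  refine ⟨fun m => ⟨(FigEightSurgery.hasSum_ZhatTermM hτ m).summable,
    FigEightSurgery.summable_ZTerm (FigEightSurgery.qpow_ne_zero τ 1)
      (FigEightSurgery.norm_qpow_one_lt_one hτ) m, FigEightSurgery.ZhatM_eq hτ m⟩, ?_, ?_⟩
  · rw [← FigEightSurgery.ZhatTermM_zero]
    exact (FigEightSurgery.hasSum_ZhatTermM hτ 0).summable
  · rw [FigEightSurgery.Zhat, ← FigEightSurgery.ZhatTermM_zero]
    exact FigEightSurgery.ZhatM_eq hτ 0
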